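/- A BL-algebra is an algebra $(A,\wedge,\vee,\odot,\to,0,1)$ such that $(A,\wedge,\vee,0,1)$ is a bounded lattice, $(A,\odot,1)$ is a commutative monoid, and for all $a,b,c\in A$: (1) $c\le a\to b$ if and only if $a\odot c\le b$; (2) $a\wedge b=a\odot(a\to b)$; (3) $(a\to b)\vee(b\to a)=1$. An endomorphism of $A$ is a map $A\to A$ preserving $\wedge,\vee,\odot,\to,0,1$. A state-operator on $A$ is a map $\sigma:A\to A$ such that for all $x,y\in A$: $\sigma(0)=0$; $\sigma(x\to y)=\sigma(x)\to\sigma(x\wedge y)$; $\sigma(x\odot y)=\sigma(x)\odot\sigma(x\to x\odot y)$; $\sigma(\sigma(x)\odot\sigma(y))=\sigma(x)\odot\sigma(y)$; and $\sigma(\sigma(x)\to\sigma(y))=\sigma(x)\to\sigma(y)$. Let $A$ be a linearly ordered BL-algebra. Then: (a) Every state-operator $\sigma$ on $A$ preserves both $\odot$ and $\to$, that is, $\sigma(x\odot y)=\sigma(x)\odot\sigma(y)$ and $\sigma(x\to y)=\sigma(x)\to\sigma(y)$ for all $x,y\in A$, and $\sigma$ is an endomorphism of $A$ such that $\sigma\circ\sigma=\sigma$.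 (b) The assignment $\sigma\mapsto\sigma$ is a one-to-one correspondence between the state-operators on $A$ and the endomorphisms $\sigma:A\to A$ such that $\sigma\circ\sigma=\sigma$. -/

import Mathlib

/-- A BL-algebra `(A, ∧, ∨, ⊙, →, 0, 1)`. The lattice operations are `⊓`, `⊔`, the product `⊙` is
`*`, the residuum `→` is `⇨`, the constant `0` is `⊥`, and the constant `1`, which is both the unit
of `⊙` and the greatest element, is `1 = ⊤`. -/
class BLAlgebra (A : Type*) extends Lattice A, BoundedOrder A, CommMonoid A, HImp A where
  /-- The monoid unit is the greatest element. -/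
  one_eq_top : (1 : A) = ⊤
  /-- Residuation: `c ≤ a → b` iff `a ⊙ c ≤ b`. -/
  le_himp_iff_mul_le : ∀ a b c : A, c ≤ a ⇨ b ↔ a * c ≤ b
  /-- Divisibility: `a ∧ b = a ⊙ (a → b)`. -/
  inf_eq_mul_himp : ∀ a b : A, a ⊓ b = a * (a ⇨ b)
  /-- Prelinearity: `(a → b) ∨ (b → a) = 1`. -/
  himp_sup_himp : ∀ a b : A, (a ⇨ b) ⊔ (b ⇨ a) = 1

/-- A homomorphism of BL-algebras: a map that preserves all the operations `∧, ∨, ⊙, →, 0, 1`. -/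
structure IsBLHom {A B : Type*} [BLAlgebra A] [BLAlgebra B] (f : A → B) : Prop where
  map_inf : ∀ x y : A, f (x ⊓ y) = f x ⊓ f y
  map_sup : ∀ x y : A, f (x ⊔ y) = f x ⊔ f y
  map_mul : ∀ x y : A, f (x * y) = f x * f y
  map_himp : ∀ x y : A, f (x ⇨ y) = f x ⇨ f y
  map_bot : f ⊥ = ⊥
  map_one : f 1 = 1

/-- A state-operator (internal state) on a BL-algebra. -/
structure IsStateOperator {A : Type*} [BLAlgebra A] (σ : A → A) : Prop where
  map_bot : σ ⊥ = ⊥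
  map_himp_inf : ∀ x y : A, σ (x ⇨ y) = σ x ⇨ σ (x ⊓ y)
  map_mul_himp : ∀ x y : A, σ (x * y) = σ x * σ (x ⇨ x * y)
  map_mul_self : ∀ x y : A, σ (σ x * σ y) = σ x * σ y
  map_himp_self : ∀ x y : A, σ (σ x ⇨ σ y) = σ x ⇨ σ y

/-!
On a chain, a state-operator `σ` is monotone (by divisibility `y = x ⊙ (x → y)` for `y ≤ x`), hence
preserves `∧` and `∨`, and it preserves `→` because `x ∧ y` is `x` or `y`. Moreover `σ ∘ σ = σ`.

The point is the product. Put `a = σ x`, `b = σ y`, which are fixed by `σ`, as is `a ⊙ b`. Since `σ`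
preserves `→`, both `u = x → a` and `v = y → b` are sent to `1`. The inequality
`σ u ⊙ σ v ≤ σ (u ⊙ v)` shows that `u ⊙ v` is also sent to `1`. As `u ⊙ v ≤ (x ⊙ y) → (a ⊙ b)`,
it follows that `σ (x ⊙ y) → (a ⊙ b) = 1`, that is, `σ (x ⊙ y) ≤ σ x ⊙ σ y`; the other inequality is
`IsStateOperator.mul_le_map_mul`. This step uses linearity only through the preservation of `→`.

Conversely, an idempotent endomorphism satisfies the axioms of a state-operator by the identities
`x → y = x → (x ∧ y)` and `x ⊙ (x → x ⊙ y) = x ⊙ y`, so the two sets of maps coincide.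
-/

namespace BLAlgebra

variable {A : Type*} [BLAlgebra A]

theorem self_le_one (a : A) : a ≤ 1 := one_eq_top (A := A) ▸ le_top

theorem mul_himp_le (a b : A) : a * (a ⇨ b) ≤ b :=
  (le_himp_iff_mul_le a b _).1 le_rfl

theorem mul_le_mul_of_le_right {b c : A} (a : A) (h : b ≤ c) : a * b ≤ a * c :=
  (le_himp_iff_mul_le a _ _).1 (h.trans ((le_himp_iff_mul_le a _ _).2 le_rfl))

theorem mul_le_mul_of_le {a b c d : A} (h₁ : a ≤ b) (h₂ : c ≤ d) : a * c ≤ b * d := by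
  refine (mul_le_mul_of_le_right a h₂).trans ?_
  rw [mul_comm a, mul_comm b]
  exact mul_le_mul_of_le_right d h₁

theorem mul_le_left (a b : A) : a * b ≤ a := by
  simpa using mul_le_mul_of_le_right a (self_le_one b)

theorem himp_eq_one_iff {a b : A} : a ⇨ b = 1 ↔ a ≤ b := by
  have h := le_himp_iff_mul_le a b 1
  rw [mul_one] at h
  exact ⟨fun e => h.1 e.ge, fun e => le_antisymm (self_le_one _) (h.2 e)⟩

theorem himp_left_inf (a b : A) : a ⇨ (a ⊓ b) = a ⇨ b := by
  refine le_antisymm ?_ ?_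
  · exact (le_himp_iff_mul_le _ _ _).2 ((mul_himp_le _ _).trans inf_le_right)
  · exact (le_himp_iff_mul_le _ _ _).2 (inf_eq_mul_himp a b).ge

theorem mul_himp_mul (a b : A) : a * (a ⇨ a * b) = a * b := by
  rw [← inf_eq_mul_himp, inf_eq_right.2 (mul_le_left a b)]

theorem himp_mul_himp_le (a b c d : A) : (a ⇨ c) * (b ⇨ d) ≤ (a * b) ⇨ (c * d) := by
  rw [le_himp_iff_mul_le, mul_mul_mul_comm]
  exact mul_le_mul_of_le (mul_himp_le a c) (mul_himp_le b d)

end BLAlgebra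

open BLAlgebra

namespace IsStateOperator

variable {A : Type*} [BLAlgebra A] {σ : A → A}

theorem map_one (h : IsStateOperator σ) : σ 1 = 1 := by
  have e := h.map_himp_inf ⊥ ⊥
  rwa [inf_idem, himp_eq_one_iff.2 le_rfl, himp_eq_one_iff.2 le_rfl] at e

theorem monotone (h : IsStateOperator σ) : Monotone σ := by
  intro y x hyx
  have e := h.map_mul_himp x (x ⇨ y)
  rw [← inf_eq_mul_himp, inf_eq_right.2 hyx] at e
  exact e ▸ mul_le_left _ _

theorem map_map (h : IsStateOperator σ) (x : A) : σ (σ x) = σ x := by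
  simpa [h.map_one] using h.map_mul_self x 1

theorem mul_le_map_mul (h : IsStateOperator σ) (x y : A) : σ x * σ y ≤ σ (x * y) := by
  rw [h.map_mul_himp x y]
  exact mul_le_mul_of_le_right _ (h.monotone ((le_himp_iff_mul_le _ _ _).2 le_rfl))

theorem map_himp (h : IsStateOperator σ) (hlin : ∀ a b : A, a ≤ b ∨ b ≤ a) (x y : A) :
    σ (x ⇨ y) = σ x ⇨ σ y := by
  rcases hlin x y with hxy | hyx
  · rw [himp_eq_one_iff.2 hxy, himp_eq_one_iff.2 (h.monotone hxy), h.map_one]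
  · rw [h.map_himp_inf, inf_eq_right.2 hyx]

/-- A state-operator that preserves `→` preserves `⊙`, because `x → σ x` and `y → σ y` both lie in
the filter `{z | σ z = 1}`. -/
theorem map_mul_of_map_himp (h : IsStateOperator σ) (hi : ∀ x y : A, σ (x ⇨ y) = σ x ⇨ σ y)
    (x y : A) : σ (x * y) = σ x * σ y := by
  refine le_antisymm ?_ (h.mul_le_map_mul x y)
  have hk : ∀ z : A, σ (z ⇨ σ z) = 1 := fun z => by
    rw [hi, h.map_map, himp_eq_one_iff.2 le_rfl]
  have h₁ := h.mul_le_map_mul (x ⇨ σ x) (y ⇨ σ y)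
  have h₂ := h.monotone (himp_mul_himp_le x y (σ x) (σ y))
  rw [hk, hk, one_mul] at h₁
  rw [hi, h.map_mul_self] at h₂
  exact himp_eq_one_iff.1 (le_antisymm (self_le_one _) (h₁.trans h₂))

theorem isBLHom (h : IsStateOperator σ) (hlin : ∀ a b : A, a ≤ b ∨ b ≤ a) : IsBLHom σ where
  map_inf x y := by
    rcases hlin x y with hxy | hxy
    · rw [inf_eq_left.2 hxy, inf_eq_left.2 (h.monotone hxy)]
    · rw [inf_eq_right.2 hxy, inf_eq_right.2 (h.monotone hxy)]
  map_sup x y := by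
    rcases hlin x y with hxy | hxy
    · rw [sup_eq_right.2 hxy, sup_eq_right.2 (h.monotone hxy)]
    · rw [sup_eq_left.2 hxy, sup_eq_left.2 (h.monotone hxy)]
  map_mul := h.map_mul_of_map_himp (h.map_himp hlin)
  map_himp := h.map_himp hlin
  map_bot := h.map_bot
  map_one := h.map_one

end IsStateOperator

theorem IsBLHom.isStateOperator {A : Type*} [BLAlgebra A] {σ : A → A} (h : IsBLHom σ)
    (hσ : σ ∘ σ = σ) : IsStateOperator σ where
  map_bot := h.map_bot
  map_himp_inf x y := by rw [h.map_himp, h.map_inf, himp_left_inf]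
  map_mul_himp x y := by rw [h.map_himp, h.map_mul, mul_himp_mul]
  map_mul_self x y := by rw [← h.map_mul]; exact congrFun hσ _
  map_himp_self x y := by rw [← h.map_himp]; exact congrFun hσ _

/-- Every state-operator on a linearly ordered BL-algebra preserves `⊙` and `→` and is an
endomorphism with `σ ∘ σ = σ`; and the identification of maps `σ ↦ σ` is a one-to-one
correspondence between state-operators and idempotent endomorphisms. -/
theorem mainTheorem1 {A : Type*} [BLAlgebra A] (hlin : ∀ a b : A, a ≤ b ∨ b ≤ a) :
    (∀ σ : A → A, IsStateOperator σ →
      (∀ x y : A, σ (x * y) = σ x * σ y) ∧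
      (∀ x y : A, σ (x ⇨ y) = σ x ⇨ σ y) ∧
      IsBLHom σ ∧ σ ∘ σ = σ) ∧
    (∃ Φ : {σ : A → A // IsStateOperator σ} ≃ {σ : A → A // IsBLHom σ ∧ σ ∘ σ = σ},
      ∀ σ : {σ : A → A // IsStateOperator σ}, (Φ σ : A → A) = (σ : A → A)) := by
  refine ⟨fun σ h => ⟨(h.isBLHom hlin).map_mul, h.map_himp hlin, h.isBLHom hlin,
    funext h.map_map⟩, Equiv.subtypeEquivRight fun σ => ⟨fun h => ⟨h.isBLHom hlin,
    funext h.map_map⟩, fun h => h.1.isStateOperator h.2⟩, fun σ => rfl⟩
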